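/- Let $\mathcal C$ be a Grothendieck category. A localizing subcategory of $\mathcal C$ is a full subcategory $\mathcal L$ closed under subobjects, quotient objects, extensions and arbitrary (small) direct sums; it is called stable if it is closed under essential extensions. For localizing subcategories $\mathcal L_1,\mathcal L_2$ let $\mathcal L_1\vee\mathcal L_2$ be the smallest localizing subcategory containing both. Let $Z(\mathcal C/\mathcal L)$ be the center of the quotient category $\mathcal C/\mathcal L$, i.e. the commutative ring of endomorphisms of its identity functor; for $\mathcal L\subseteq\mathcal L'$ the quotient functor $\mathcal C/\mathcal L\to\mathcal C/\mathcal L'$ induces a ring homomorphism $Z(\mathcal C/\mathcal L)\to Z(\mathcal C/\mathcal L')$. Let $\mathbf L^{st}(\mathcal C)$ be the category whose objects are the stable localizing subcategories of $\mathcal C$, with a unique morphism $\mathcal L_2\to\mathcal L_1$ whenever $\mathcal L_1\subseteq\mathcal L_2$ and no others. Call a finite family $\{\mathcal L_i\to\mathcal L\}_{1\le i\le n}$ in $\mathbf L^{st}(\mathcal C)$ a covering of $\mathcal L$ if $\mathcal L=\bigcap_{i=1}^n\mathcal L_i$ (the empty intersection being $\mathcal C$). (1) $\mathbf L^{st}(\mathcal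 C)$ has fibre products, these coverings form a Grothendieck pretopology on it, and $\mathcal L\mapsto Z(\mathcal C/\mathcal L)$ is a sheaf of commutative rings on the resulting site. (2) For any $n\ge 0$ and any stable localizing subcategories $\mathcal L_1,\dots,\mathcal L_n$ of $\mathcal C$ the natural sequence $$0\to Z\Big(\mathcal C/\bigcap_{i}\mathcal L_i\Big)\to\prod_{i}Z(\mathcal C/\mathcal L_i)\rightrightarrows\prod_{i,j}Z\big(\mathcal C/(\mathcal L_i\vee\mathcal L_j)\big)$$ is exact, i.e. the first map is injective and its image is the equalizer of the two parallel maps. -/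

import Mathlib

open CategoryTheory CategoryTheory.Limits Opposite

universe w v u

/-- A monomorphism `f : X ⟶ Y` in an abelian category is an essential extension of `X` if every
subobject of `Y` whose intersection with `X` is zero is itself zero. -/
def IsEssentialExtension {C : Type u} [Category.{v} C] [Abelian C] {X Y : C} (f : X ⟶ Y) : Prop :=
  Mono f ∧ ∀ (Z : C) (g : Z ⟶ Y), Mono g → IsZero (pullback f g) → IsZero Z

/-- A localizing subcategory of a Grothendieck category: a full subcategory (given by its class of
objects) which is closed under subobjects, quotient objects and extensions, and under arbitrary
(small) direct sums. -/
structure LocalizingSubcategory (C : Type u) [Category.{v} C] [Abelian C] where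
  /-- The class of objects of the subcategory. -/
  obj : ObjectProperty C
  isSerreClass : obj.IsSerreClass
  closedUnderCoproducts : ∀ J : Type w, obj.IsClosedUnderColimitsOfShape (Discrete J)

namespace LocalizingSubcategory

variable {C : Type u} [Category.{v} C] [Abelian C]

attribute [instance] isSerreClass closedUnderCoproducts

theorem obj_injective :
    Function.Injective (obj : LocalizingSubcategory.{w} C → ObjectProperty C) := by
  rintro ⟨_, _, _⟩ ⟨_, _, _⟩ h
  cases h
  rfl

/-- Localizing subcategories are ordered by inclusion. -/
instance : PartialOrder (LocalizingSubcategory.{w} C) :=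
  PartialOrder.lift obj obj_injective

/-- The intersection of a family of localizing subcategories. -/
instance : InfSet (LocalizingSubcategory.{w} C) where
  sInf S :=
    { obj := fun X => ∀ L ∈ S, L.obj X
      isSerreClass :=
        { exists_zero := ⟨_, isZero_zero C, fun L _ =>
            L.obj.prop_of_isZero (isZero_zero C)⟩
          prop_of_mono := fun f _ hY L hL => L.obj.prop_of_mono f (hY L hL)
          prop_of_epi := fun f _ hX L hL => L.obj.prop_of_epi f (hX L hL)
          prop_X₂_of_shortExact := fun h h₁ h₃ L hL =>
            L.obj.prop_X₂_of_shortExact h (h₁ L hL) (h₃ L hL) }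
      closedUnderCoproducts := fun J =>
        { colimitsOfShape_le := by
            rintro X ⟨p⟩ L hL
            exact (L.obj.colimitsOfShape_le (J := Discrete J)) _
              ⟨{ p with prop_diag_obj := fun j => p.prop_diag_obj j L hL }⟩ } }

/-- The complete lattice of localizing subcategories: infima are intersections, and `L₁ ⊔ L₂` is the
smallest localizing subcategory containing `L₁` and `L₂`. -/
instance : CompleteLattice (LocalizingSubcategory.{w} C) :=
  completeLatticeOfInf _ fun _ =>
    ⟨fun L hL _ hX => hX L hL, fun _ hL' X hX _ hL => hL' hL X hX⟩

theorem sInf_obj_iff (S : Set (LocalizingSubcategory.{w} C)) (X : C) :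
    (sInf S).obj X ↔ ∀ L ∈ S, L.obj X :=
  Iff.rfl

theorem iInf_obj_iff {ι : Type*} (L : ι → LocalizingSubcategory.{w} C) (X : C) :
    (⨅ i, L i).obj X ↔ ∀ i, (L i).obj X := by
  rw [iInf, sInf_obj_iff, Set.forall_mem_range]

theorem sup_obj_iff (L₁ L₂ : LocalizingSubcategory.{w} C) (X : C) :
    (L₁ ⊔ L₂).obj X ↔ ∀ L : LocalizingSubcategory.{w} C, L₁ ≤ L → L₂ ≤ L → L.obj X :=
  ⟨fun h _ h₁ h₂ => (sup_le h₁ h₂ : L₁ ⊔ L₂ ≤ _) X h, fun h => h _ le_sup_left le_sup_right⟩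

/-- A localizing subcategory is stable if it is closed under essential extensions. -/
def IsStable (L : LocalizingSubcategory.{w} C) : Prop :=
  ∀ ⦃X Y : C⦄ (f : X ⟶ Y), IsEssentialExtension f → L.obj X → L.obj Y

/-- The quotient category `C/L`: the localization of `C` at the morphisms whose kernel and cokernel
lie in `L`. -/
abbrev QuotientCat (L : LocalizingSubcategory.{w} C) : Type u :=
  L.obj.isoModSerre.Localization

/-- The quotient functor `C ⥤ C/L`. -/
abbrev toQuotient (L : LocalizingSubcategory.{w} C) : C ⥤ L.QuotientCat :=
  L.obj.isoModSerre.Q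

/-- The center `Z(C/L)`: the endomorphism ring of the identity functor of `C/L`. -/
abbrev Center (L : LocalizingSubcategory.{w} C) : Type max u v :=
  CatCenter L.QuotientCat

noncomputable instance (L : LocalizingSubcategory.{w} C) : CommRing L.Center :=
  { (inferInstance : Ring L.Center) with
    mul_comm := fun x y => IsMulCommutative.is_comm.comm x y }

variable {L L' L'' : LocalizingSubcategory.{w} C}

theorem isoModSerre_le (h : L ≤ L') : L.obj.isoModSerre ≤ L'.obj.isoModSerre :=
  fun _ _ _ hf => ⟨h _ hf.1, h _ hf.2⟩

theorem isInvertedBy (h : L ≤ L') : L.obj.isoModSerre.IsInvertedBy L'.toQuotient :=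
  fun _ _ f hf => L'.obj.isoModSerre.Q_inverts f (isoModSerre_le h f hf)

/-- For `L ⊆ L'`, the natural functor `C/L ⥤ C/L'`: the unique functor whose composite with
`C ⥤ C/L` is `C ⥤ C/L'`. -/
noncomputable def quotientFunctor (h : L ≤ L') : L.QuotientCat ⥤ L'.QuotientCat :=
  Localization.Construction.lift L'.toQuotient (isInvertedBy h)

theorem toQuotient_comp (h : L ≤ L') : L.toQuotient ⋙ quotientFunctor h = L'.toQuotient :=
  Localization.Construction.fac _ _

instance (h : L ≤ L') : (quotientFunctor h).IsLocalization
    (L'.obj.isoModSerre.map L.toQuotient) := by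
  have : (L.toQuotient ⋙ quotientFunctor h).IsLocalization L'.obj.isoModSerre := by
    rw [toQuotient_comp]
    infer_instance
  exact Functor.IsLocalization.of_comp L.toQuotient _ L.obj.isoModSerre _ L'.obj.isoModSerre
    (isoModSerre_le h) rfl

instance (h : L ≤ L') : (quotientFunctor h).Additive := by
  rw [Localization.functor_additive_iff L.toQuotient L.obj.isoModSerre, toQuotient_comp]
  infer_instance

/-- For `L ⊆ L'`, the ring homomorphism `Z(C/L) → Z(C/L')` induced by the quotient functor
`C/L ⥤ C/L'`. -/
noncomputable def centerMap (h : L ≤ L') : L.Center →+* L'.Center :=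
  CatCenter.localizationRingHom (quotientFunctor h) (L'.obj.isoModSerre.map L.toQuotient)

/-- On the image of `X : C`, the element `centerMap h z` acts as the image of the action of `z`. -/
theorem centerMap_app (h : L ≤ L') (z : L.Center) (X : C) :
    (centerMap h z).app (L'.toQuotient.obj X) =
      (quotientFunctor h).map (z.app (L.toQuotient.obj X)) :=
  CatCenter.localization_app z (quotientFunctor h) _ (L.toQuotient.obj X)

theorem center_ext {z z' : L.Center}
    (h : ∀ X : C, z.app (L.toQuotient.obj X) = z'.app (L.toQuotient.obj X)) : z = z' :=
  CatCenter.ext_of_localization L.toQuotient L.obj.isoModSerre z z' h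

theorem quotientFunctor_refl : quotientFunctor (le_refl L) = 𝟭 _ :=
  Localization.Construction.uniq _ _ (toQuotient_comp _)

theorem quotientFunctor_trans (h : L ≤ L') (h' : L' ≤ L'') :
    quotientFunctor (h.trans h') = quotientFunctor h ⋙ quotientFunctor h' :=
  Localization.Construction.uniq _ _ (by
    rw [← Functor.assoc, toQuotient_comp, toQuotient_comp, toQuotient_comp])

theorem centerMap_refl (z : L.Center) : centerMap (le_refl L) z = z :=
  center_ext fun X => by
    rw [centerMap_app]
    exact (Functor.congr_hom quotientFunctor_refl (z.app (L.toQuotient.obj X))).trans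
      ((Category.id_comp _).trans (Category.comp_id _))

theorem centerMap_trans (h : L ≤ L') (h' : L' ≤ L'') (z : L.Center) :
    centerMap (h.trans h') z = centerMap h' (centerMap h z) :=
  center_ext fun X => by
    rw [centerMap_app, centerMap_app, centerMap_app]
    exact (Functor.congr_hom (quotientFunctor_trans h h') (z.app (L.toQuotient.obj X))).trans
      ((Category.id_comp _).trans (Category.comp_id _))

end LocalizingSubcategory

section

variable (C : Type u) [Category.{v} C] [Abelian C]

/-- The stable localizing subcategories of `C`, partially ordered by reverse inclusion. As a
category, it has a (unique) morphism `L₂ ⟶ L₁` exactly when `L₁ ⊆ L₂`. -/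
abbrev StableLocalizing : Type u :=
  { L : LocalizingSubcategory.{w} C // L.IsStable }ᵒᵈ

/-- The localizing subcategory underlying an object of `StableLocalizing C`. -/
abbrev StableLocalizing.toLocalizing {C : Type u} [Category.{v} C] [Abelian C]
    (L : StableLocalizing.{w} C) : LocalizingSubcategory.{w} C :=
  (OrderDual.ofDual L).1

/-- A morphism `L₂ ⟶ L₁` of `StableLocalizing C` is an inclusion `L₁ ⊆ L₂`. -/
theorem StableLocalizing.le_of_hom {C : Type u} [Category.{v} C] [Abelian C]
    {L₂ L₁ : StableLocalizing.{w} C} (f : L₂ ⟶ L₁) : L₁.toLocalizing ≤ L₂.toLocalizing :=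
  leOfHom f

/-- The coverings of `L`: the finite families `Lᵢ ⟶ L`, `1 ≤ i ≤ n`, with `L = L₁ ∩ ⋯ ∩ Lₙ`. -/
def stableCoverings : Precoverage (StableLocalizing.{w} C) where
  coverings L := { R | ∃ (n : ℕ) (M : Fin n → StableLocalizing.{w} C) (f : ∀ i, M i ⟶ L),
    R = Presieve.ofArrows M f ∧ L.toLocalizing = ⨅ i, (M i).toLocalizing }

/-- The presheaf of commutative rings `L ↦ Z(C/L)` on the category of stable localizing
subcategories of `C`. -/
noncomputable def centralPresheaf : (StableLocalizing.{w} C)ᵒᵖ ⥤ CommRingCat.{max u v} where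
  obj L := CommRingCat.of L.unop.toLocalizing.Center
  map f := CommRingCat.ofHom
    (LocalizingSubcategory.centerMap (StableLocalizing.le_of_hom f.unop))
  map_id _ := CommRingCat.hom_ext <| RingHom.ext fun z =>
    LocalizingSubcategory.centerMap_refl z
  map_comp f g := CommRingCat.hom_ext <| RingHom.ext fun z =>
    LocalizingSubcategory.centerMap_trans (StableLocalizing.le_of_hom f.unop)
      (StableLocalizing.le_of_hom g.unop) z

end

/-! Everything is reduced to injective objects. If `L` is stable, an injective `E` splits as `T ⊞ F`
with `T` in `L` and `F` torsion-free (`IsStable.exists_iso_biprod`). Splitting repeatedly for `L₁,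
…, Lₙ` gives injective summands `K`, each of which, for every `i`, is in `Lᵢ` or `Lᵢ`-torsion-free.
In the first case `zᵢ` acts as zero; in the second, maps into `K` are the same in `C` and in `C/Lᵢ`,
so `zᵢ` is an honest endomorphism of `K`. If `K` is torsion-free for `Lᵢ` and `Lⱼ`, it is so for `Lᵢ
⊔ Lⱼ`, and compatibility makes the two endomorphisms equal in `C`. An arbitrary object is the kernel
of a map of injectives, and the exact quotient functor carries the gluing over.

Uniqueness and naturality come from joint faithfulness: a map of `C` dies in `C/L` exactly when its
image lies in `L`, and this condition respects intersections.

For the site, fibre products are joins. The same splitting shows that joins are stable and that a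
`B`-torsion-free object of `A ⊔ B` lies in `A`; hence coverings are stable under pullback. -/

section

variable {C : Type u} [Category.{v} C] [Abelian C]

/-! ### Essential extensions obtained from quotients. -/

/-- If a subobject of `E` meets each member of a directed family of subobjects trivially, then it
embeds into a quotient of `E` which kills all of them. -/
theorem exists_mono_comp_of_directed [IsGrothendieckAbelian.{w} C] {T E : C} (i : T ⟶ E)
    {J : Type w} [Preorder J] [IsDirectedOrder J] [Nonempty J] (D : J → Subobject E)
    (hD : Monotone D) (hmono : ∀ j, Mono (i ≫ cokernel.π (D j).arrow)) :
    ∃ (Y : C) (q : E ⟶ Y), Mono (i ≫ q) ∧ ∀ j, (D j).arrow ≫ q = 0 := by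
  let F : J ⥤ C :=
    { obj := fun j => cokernel (D j).arrow
      map := fun {j k} f => cokernel.desc _ (cokernel.π (D k).arrow) (by
        rw [← Subobject.ofLE_arrow (hD (leOfHom f)), Category.assoc, cokernel.condition, comp_zero])
      map_id := fun j => by ext; simp
      map_comp := fun f g => by ext; simp }
  let α : (Functor.const J).obj T ⟶ F :=
    { app := fun j => i ≫ cokernel.π (D j).arrow
      naturality := fun j k f => by simp [F] }
  have : ∀ j, Mono (α.app j) := hmono
  have := NatTrans.mono_of_mono_app α
  have hle : ∀ j k : J, j ≤ k → cokernel.π (D j).arrow ≫ colimit.ι F j =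
      cokernel.π (D k).arrow ≫ colimit.ι F k := fun j k h => by
    rw [← colimit.w F (homOfLE h)]
    simp [F]
  have hq : ∀ j k : J, cokernel.π (D j).arrow ≫ colimit.ι F j =
      cokernel.π (D k).arrow ≫ colimit.ι F k := fun j k => by
    obtain ⟨l, hj, hk⟩ := exists_ge_ge j k
    rw [hle j l hj, hle k l hk]
  let j₀ : J := Classical.arbitrary J
  refine ⟨colimit F, cokernel.π (D j₀).arrow ≫ colimit.ι F j₀, ?_, fun j => ?_⟩
  -- Filtered colimits are exact, and the constant diagram on `T` has colimit `T` since `J` is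
  -- connected.
  · have := IsFiltered.isConnected J
    refine colim.map_mono' α (isColimitConstCocone J T) (colimit.isColimit F) _ fun j => ?_
    exact (Category.id_comp _).trans
      ((congrArg (i ≫ ·) (hq j₀ j)).trans (Category.assoc _ _ _).symm)
  · rw [hq j₀ j, ← Category.assoc, cokernel.condition, zero_comp]

/-- Every monomorphism `T ⟶ E` becomes an essential extension after passing to a suitable quotient
of `E`. -/
theorem exists_isEssentialExtension_comp [IsGrothendieckAbelian.{w} C] {T E : C} (i : T ⟶ E)
    [Mono i] : ∃ (Y : C) (q : E ⟶ Y), IsEssentialExtension (i ≫ q) := by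
  have key : ∀ {Y : C} (q : E ⟶ Y), Mono (i ≫ q) →
      Mono (i ≫ cokernel.π (Subobject.mk (kernel.ι q)).arrow) := fun q hq => by
    have h0 : (Subobject.mk (kernel.ι q)).arrow ≫ q = 0 := by
      rw [← Subobject.underlyingIso_hom_comp_eq_mk, Category.assoc, kernel.condition, comp_zero]
    have : Mono ((i ≫ cokernel.π (Subobject.mk (kernel.ι q)).arrow) ≫ cokernel.desc _ q h0) := by
      simpa using hq
    exact mono_of_mono _ (cokernel.desc _ q h0)
  -- Zorn on the subobjects `K` with `T ⟶ E/K` mono, starting from the zero subobject; `Shrink`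
  -- brings a chain down to universe `w`.
  obtain ⟨K, -, hK⟩ := zorn_le_nonempty₀ {K : Subobject E | Mono (i ≫ cokernel.π K.arrow)}
    (fun c hcs hc y hy => by
      let e := (equivShrink.{w} c).symm
      let : Preorder (Shrink.{w} c) := Preorder.lift fun j => (e j).1
      have : Nonempty (Shrink.{w} c) := ⟨e.symm ⟨y, hy⟩⟩
      have : IsDirectedOrder (Shrink.{w} c) := ⟨fun j k => (hc.total (e j).2 (e k).2).elim
        (fun h => ⟨k, h, le_rfl⟩) fun h => ⟨j, le_rfl, h⟩⟩
      obtain ⟨Y, q, hq, h⟩ := exists_mono_comp_of_directed i (fun j => (e j).1) (fun _ _ h => h)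
        fun j => hcs (e j).2
      refine ⟨_, key q hq, fun K hK => ?_⟩
      obtain ⟨j, rfl⟩ : ∃ j, (e j).1 = K := ⟨e.symm ⟨K, hK⟩, by rw [e.apply_symm_apply]⟩
      exact Subobject.le_mk_of_comm (kernel.lift q _ (h j)) (kernel.lift_ι _ _ _))
    (Subobject.mk (kernel.ι (𝟙 E))) (key (𝟙 E) (by simpa))
  have : Mono (i ≫ cokernel.π K.arrow) := hK.prop
  refine ⟨_, cokernel.π K.arrow, hK.prop, fun Z g _ hZ => ?_⟩
  -- `Z` meets `T` trivially, so `T` still embeds after dividing by the preimage of `Z`; by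
  -- maximality this preimage is `K`, so `Z` is zero.
  let q := cokernel.π K.arrow ≫ cokernel.π g
  have hq : Mono (i ≫ q) := by
    refine Preadditive.mono_of_cancel_zero _ fun {A} a ha => ?_
    have h1 : (a ≫ i ≫ cokernel.π K.arrow) ≫ cokernel.π g = 0 := by simpa [q] using ha
    have h2 := (Abelian.monoLift_comp g (a ≫ i ≫ cokernel.π K.arrow) h1)
    have h3 : a = pullback.lift (f := i ≫ cokernel.π K.arrow) (g := g) a _ h2.symm ≫
      pullback.fst _ _ := (pullback.lift_fst _ _ _).symm
    rw [h3, hZ.eq_of_tgt (pullback.lift a _ h2.symm) 0, zero_comp]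
  have h1 : Subobject.mk (kernel.ι q) ≤ K :=
    hK.le_of_ge (key q hq) (Subobject.le_mk_of_comm
      (kernel.lift q K.arrow (by simp [q])) (kernel.lift_ι _ _ _))
  have h2 : kernel.ι q ≫ cokernel.π K.arrow = 0 := by
    rw [← Subobject.ofMkLE_arrow h1, Category.assoc, cokernel.condition, comp_zero]
  have h3 := Abelian.comp_epiDesc q (cokernel.π K.arrow) h2
  have h4 : cokernel.π g ≫ Abelian.epiDesc q (cokernel.π K.arrow) h2 = 𝟙 _ := by
    rw [← cancel_epi (cokernel.π K.arrow), ← Category.assoc, Category.comp_id]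
    exact h3
  have h5 : g = 0 := by
    rw [← Category.comp_id g, ← h4, ← Category.assoc, cokernel.condition, zero_comp]
  rw [IsZero.iff_id_eq_zero, ← cancel_mono g, h5, comp_zero, comp_zero]

/-! ### Torsion and the splitting of injectives. -/

namespace LocalizingSubcategory

variable (L : LocalizingSubcategory.{w} C)

/-- An object is `L`-torsion-free if it receives no nonzero morphism from an object of `L`. -/
def TorsionFree (X : C) : Prop :=
  ∀ ⦃T : C⦄, L.obj T → ∀ f : T ⟶ X, f = 0

variable {L}

theorem TorsionFree.of_mono {X Y : C} (hY : L.TorsionFree Y) (f : X ⟶ Y) [Mono f] :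
    L.TorsionFree X := fun _ hT g => by
  rw [← cancel_mono f, hY hT (g ≫ f), zero_comp]

variable (L)

/-- Every object is an extension of an `L`-torsion-free object by an object of `L`. -/
theorem exists_shortExact [IsGrothendieckAbelian.{w} C] (X : C) :
    ∃ (T F : C) (i : T ⟶ X) (p : X ⟶ F) (h : i ≫ p = 0), (ShortComplex.mk i p h).ShortExact ∧
      L.obj T ∧ L.TorsionFree F := by
  -- The torsion part is the sum of all subobjects in `L`, a small family because `C` is
  -- well-powered.
  let J := Shrink.{w} {K : Subobject X // L.obj (K : C)}
  let e : J ≃ {K : Subobject X // L.obj (K : C)} := (equivShrink.{w} _).symm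
  let p : (∐ fun j : J => ((e j).1 : C)) ⟶ X := Sigma.desc fun j => (e j).1.arrow
  have hcop : L.obj (∐ fun j : J => ((e j).1 : C)) :=
    L.obj.prop_colimit _ fun j => (e j.as).2
  have himg : L.obj (Abelian.image p) := L.obj.prop_of_epi (Abelian.factorThruImage p) hcop
  have harrow : ∀ j : J, (e j).1.arrow ≫ cokernel.π p = 0 := fun j => by
    have : (e j).1.arrow = Sigma.ι (fun j : J => ((e j).1 : C)) j ≫ p := by simp [p]
    rw [this, Category.assoc, cokernel.condition, comp_zero]
  have hfac : ∀ ⦃Z : C⦄, L.obj Z → ∀ f : Z ⟶ X, f ≫ cokernel.π p = 0 := fun Z hZ f => by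
    have hK : L.obj ((Subobject.mk (Abelian.image.ι f) : Subobject X) : C) :=
      L.obj.prop_of_iso (Subobject.underlyingIso _).symm
        (L.obj.prop_of_epi (Abelian.factorThruImage f) hZ)
    have h1 := harrow (e.symm ⟨_, hK⟩)
    rw [e.apply_symm_apply] at h1
    rw [← Abelian.image.fac f, ← Subobject.underlyingIso_arrow (Abelian.image.ι f), Category.assoc,
      Category.assoc, h1, comp_zero, comp_zero]
  refine ⟨_, _, Abelian.image.ι p, cokernel.π p, by simp,
    { exact := ShortComplex.exact_of_f_is_kernel _ (kernelIsKernel (cokernel.π p)) },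
    himg, fun T hT f => ?_⟩
  -- The pullback of `f` to `X` is an extension of `T` by a subobject of the torsion part, so it
  -- lies in `L` and dies in the quotient.
  have hk : L.obj (kernel (pullback.snd (cokernel.π p) f)) := by
    let k : kernel (pullback.snd (cokernel.π p) f) ⟶ kernel (cokernel.π p) :=
      kernel.lift (cokernel.π p) (kernel.ι (pullback.snd (cokernel.π p) f) ≫ pullback.fst _ _)
        (by rw [Category.assoc, pullback.condition, kernel.condition_assoc, zero_comp])
    have hk : k ≫ kernel.ι _ = kernel.ι (pullback.snd (cokernel.π p) f) ≫ pullback.fst _ _ :=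
      kernel.lift_ι _ _ _
    have : Mono k := Preadditive.mono_of_cancel_zero _ fun {A} a ha => by
      rw [← cancel_mono (kernel.ι (pullback.snd (cokernel.π p) f)), zero_comp]
      ext
      · rw [Category.assoc, ← hk, ← Category.assoc, ha, zero_comp, zero_comp]
      · simp
    exact L.obj.prop_of_mono k himg
  have hP : L.obj (pullback (cokernel.π p) f) :=
    L.obj.prop_X₂_of_exact (ShortComplex.exact_kernel (pullback.snd (cokernel.π p) f)) hk hT
  rw [← cancel_epi (pullback.snd (cokernel.π p) f), ← pullback.condition,
    hfac hP (pullback.fst _ _), comp_zero]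

variable {L}

/-- The objects with no nonzero map to `K` form a localizing subcategory, injectivity giving closure
under subobjects; minimality of the join applies. -/
theorem torsionFree_sup_of_injective {L₁ L₂ : LocalizingSubcategory.{w} C} {K : C} [Injective K]
    (h₁ : L₁.TorsionFree K) (h₂ : L₂.TorsionFree K) : (L₁ ⊔ L₂).TorsionFree K := by
  let M : LocalizingSubcategory.{w} C :=
    { obj := fun X => ∀ f : X ⟶ K, f = 0
      isSerreClass :=
        { exists_zero := ⟨_, isZero_zero C, fun f => (isZero_zero C).eq_of_src _ _⟩
          prop_of_mono := fun f _ hY g => by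
            rw [← Injective.comp_factorThru g f,
              show Injective.factorThru g f = 0 from hY _, comp_zero]
          prop_of_epi := fun f _ hX g => by
            rw [← cancel_epi f, hX (f ≫ g), comp_zero]
          prop_X₂_of_shortExact := fun {S} h h₁ h₃ g => by
            have := h.epi_g
            rw [← h.exact.g_desc g (h₁ _), show h.exact.desc g (h₁ _) = 0 from h₃ _, comp_zero] }
      closedUnderCoproducts := fun J =>
        { colimitsOfShape_le := by
            rintro X ⟨p⟩ g
            exact p.isColimit.hom_ext fun j => by
              rw [p.prop_diag_obj j (p.ι.app j ≫ g), comp_zero] } }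
  exact fun T hT => (sup_le (fun _ hX f => h₁ hX f) (fun _ hX f => h₂ hX f) : L₁ ⊔ L₂ ≤ M) T hT

/-- For a stable localizing subcategory, the torsion subobject of an injective object is a direct
summand. -/
theorem IsStable.exists_iso_biprod [IsGrothendieckAbelian.{w} C] (hL : L.IsStable) (E : C)
    [Injective E] : ∃ (T F : C) (_ : E ≅ T ⊞ F), Injective T ∧ Injective F ∧ L.obj T ∧
      L.TorsionFree F := by
  obtain ⟨T, F, i, p, w, hS, hT, hF⟩ := L.exists_shortExact E
  have := hS.mono_f
  have := hS.epi_g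
  obtain ⟨Y, q, hq⟩ := exists_isEssentialExtension_comp.{w} i
  have hY : L.obj Y := hL _ hq hT
  have hm := hq.1
  -- `Y` is in `L` by stability and `F` is torsion-free, so `g` lands in `T`; preceded by `q` it
  -- retracts `i`.
  let g : Y ⟶ E := Injective.factorThru i (i ≫ q)
  have hg : (i ≫ q) ≫ g = i := Injective.comp_factorThru i (i ≫ q)
  have hr : hS.exact.lift g (hF hY _) ≫ i = g := hS.exact.lift_f g (hF hY _)
  let s := ShortComplex.Splitting.ofExactOfRetraction _ hS.exact (q ≫ hS.exact.lift g (hF hY _))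
    (by
      rw [← cancel_mono i]
      simpa [hr] using hg) this
  refine ⟨T, F, s.isoBinaryBiproduct, ?_, ?_, hT, hF⟩
  · exact Retract.injective (Y := E) { i := i, r := s.r, retract := s.f_r }
  · exact Retract.injective (Y := E) { i := s.s, r := p, retract := s.s_g }

end LocalizingSubcategory

end

/-! ### Morphisms in quotient categories. -/

namespace LocalizingSubcategory

variable {C : Type u} [Category.{v} C] [Abelian C] {L L' : LocalizingSubcategory.{w} C}

theorem quotientFunctor_map (h : L ≤ L') {X Y : C} (f : X ⟶ Y) :
    (quotientFunctor h).map (L.toQuotient.map f) = L'.toQuotient.map f :=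
  (Functor.congr_hom (toQuotient_comp h) f).trans
    ((Category.id_comp _).trans (Category.comp_id _))

theorem toQuotient_map_eq_zero_iff {X Y : C} (f : X ⟶ Y) :
    L.toQuotient.map f = 0 ↔ L.obj (Abelian.image f) :=
  ObjectProperty.SerreClassLocalization.map_eq_zero_iff _ L.obj f

theorem isZero_toQuotient_obj {X : C} (hX : L.obj X) : IsZero (L.toQuotient.obj X) :=
  (ObjectProperty.SerreClassLocalization.isZero_obj_iff _ L.obj X).2 hX

instance : L.toQuotient.PreservesMonomorphisms :=
  ObjectProperty.SerreClassLocalization.preservesMonomorphisms _ L.obj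

/-- If `L` is the intersection of the `M i`, then the functors `C/L ⥤ C/(M i)` are jointly
faithful. -/
theorem hom_ext_of_quotientFunctor_map_eq {ι : Type*} {M : ι → LocalizingSubcategory.{w} C}
    (h : ∀ i, L ≤ M i) (hL : ∀ X, (∀ i, (M i).obj X) → L.obj X) {X Y : C}
    {f g : L.toQuotient.obj X ⟶ L.toQuotient.obj Y}
    (hfg : ∀ i, (quotientFunctor (h i)).map f = (quotientFunctor (h i)).map g) : f = g := by
  rw [← sub_eq_zero]
  -- Up to the isomorphism induced by `φ.s`, the difference is the image of `φ.f` in `C`, whose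
  -- vanishing is tested on its image object.
  obtain ⟨φ, hφ⟩ := Localization.exists_leftFraction L.toQuotient L.obj.isoModSerre (f - g)
  have hs := L.obj.isoModSerre.Q_inverts φ.s φ.hs
  have h1 : (f - g) ≫ L.toQuotient.map φ.s = L.toQuotient.map φ.f := by
    rw [hφ]
    exact MorphismProperty.LeftFraction.map_comp_map_s _ _ _
  rw [← cancel_mono (L.toQuotient.map φ.s), h1, zero_comp, toQuotient_map_eq_zero_iff]
  refine hL _ fun i => ?_
  rw [← toQuotient_map_eq_zero_iff, ← quotientFunctor_map (h i), ← h1, Functor.map_comp,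
    Functor.map_sub, hfg, sub_self, zero_comp]
  rfl

section Local

variable {K : C}

theorem TorsionFree.map_injective (hK : L.TorsionFree K) {X : C} {f g : X ⟶ K}
    (h : L.toQuotient.map f = L.toQuotient.map g) : f = g := by
  rw [← sub_eq_zero, ← Functor.map_sub, toQuotient_map_eq_zero_iff] at h
  rw [← sub_eq_zero, ← Abelian.image.fac (f - g), hK h (Abelian.image.ι (f - g)), comp_zero]

theorem TorsionFree.exists_retraction [Injective K] (hK : L.TorsionFree K) {Y : C} (s : K ⟶ Y)
    (hs : L.obj.isoModSerre s) : ∃ r : Y ⟶ K, s ≫ r = 𝟙 K := by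
  have : Mono s := Preadditive.mono_of_kernel_zero (hK hs.1 _)
  exact ⟨Injective.factorThru (𝟙 K) s, Injective.comp_factorThru _ _⟩

/-- Morphisms in `C/L` into a torsion-free injective object come from `C`. -/
theorem TorsionFree.map_surjective [Injective K] (hK : L.TorsionFree K) {X : C}
    (φ : L.toQuotient.obj X ⟶ L.toQuotient.obj K) : ∃ f : X ⟶ K, L.toQuotient.map f = φ := by
  obtain ⟨ψ, hψ⟩ := Localization.exists_leftFraction L.toQuotient L.obj.isoModSerre φ
  have hs := L.obj.isoModSerre.Q_inverts ψ.s ψ.hs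
  -- The denominator is a split monomorphism, so it can be cleared in `C`.
  obtain ⟨r, hr⟩ := hK.exists_retraction ψ.s ψ.hs
  have h1 : φ ≫ L.toQuotient.map ψ.s = L.toQuotient.map ψ.f := by
    rw [hψ]
    exact MorphismProperty.LeftFraction.map_comp_map_s _ _ _
  refine ⟨ψ.f ≫ r, ?_⟩
  rw [Functor.map_comp, ← h1, Category.assoc, ← Functor.map_comp, hr, CategoryTheory.Functor.map_id,
    Category.comp_id]

end Local

/-! ### Gluing central elements. -/

section Gluing

variable {ι : Type*} {M : ι → LocalizingSubcategory.{w} C}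

/-- An endomorphism of the image of `X` in `C/L` which lifts the action of each element `z i` of
the center of `C/(M i)`. -/
def IsGluingAt (h : ∀ i, L ≤ M i) (z : ∀ i, (M i).Center) (X : C)
    (e : L.toQuotient.obj X ⟶ L.toQuotient.obj X) : Prop :=
  ∀ i, (quotientFunctor (h i)).map e = (z i).app ((M i).toQuotient.obj X)

variable {h : ∀ i, L ≤ M i} {z : ∀ i, (M i).Center}

theorem IsGluingAt.naturality (hL : ∀ X, (∀ i, (M i).obj X) → L.obj X) {X Y : C}
    {e : L.toQuotient.obj X ⟶ L.toQuotient.obj X} {e' : L.toQuotient.obj Y ⟶ L.toQuotient.obj Y}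
    (he : IsGluingAt h z X e) (he' : IsGluingAt h z Y e') (f : X ⟶ Y) :
    L.toQuotient.map f ≫ e' = e ≫ L.toQuotient.map f :=
  hom_ext_of_quotientFunctor_map_eq h hL fun i => by
    rw [Functor.map_comp, Functor.map_comp, he i, he' i, quotientFunctor_map]
    exact CatCenter.naturality _ _

/-- Centrality of `z i` moves it past the projections and inclusions, so only the resolution of the
identity of `E` is needed. -/
theorem exists_isGluingAt_of_total {E X Y : C} {p : E ⟶ X} {j : X ⟶ E} {p' : E ⟶ Y} {j' : Y ⟶ E}
    (total : p ≫ j + p' ≫ j' = 𝟙 E) (hX : ∃ e, IsGluingAt h z X e)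
    (hY : ∃ e, IsGluingAt h z Y e) : ∃ e, IsGluingAt h z E e := by
  obtain ⟨e, he⟩ := hX
  obtain ⟨e', he'⟩ := hY
  refine ⟨L.toQuotient.map p ≫ e ≫ L.toQuotient.map j +
    L.toQuotient.map p' ≫ e' ≫ L.toQuotient.map j', fun i => ?_⟩
  rw [Functor.map_add, Functor.map_comp, Functor.map_comp, Functor.map_comp, Functor.map_comp,
    he i, he' i, quotientFunctor_map, quotientFunctor_map, quotientFunctor_map,
    quotientFunctor_map]
  have key : (M i).toQuotient.map p ≫ (M i).toQuotient.map j ≫ (z i).app _ +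
      (M i).toQuotient.map p' ≫ (M i).toQuotient.map j' ≫ (z i).app _ =
        (z i).app ((M i).toQuotient.obj E) := by
    simp only [← Category.assoc, ← Functor.map_comp, ← Preadditive.add_comp, ← Functor.map_add]
    rw [total, CategoryTheory.Functor.map_id, Category.id_comp]
  rw [CatCenter.naturality, CatCenter.naturality] at key
  exact key

theorem exists_isGluingAt_of_decided
    (hz : ∀ i j, centerMap (le_sup_left : M i ≤ M i ⊔ M j) (z i) =
      centerMap (le_sup_right : M j ≤ M i ⊔ M j) (z j)) {K : C} [Injective K]
    (hK : ∀ i, (M i).obj K ∨ (M i).TorsionFree K) : ∃ e, IsGluingAt h z K e := by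
  by_cases hall : ∀ i, (M i).obj K
  · exact ⟨0, fun i => (isZero_toQuotient_obj (hall i)).eq_of_src _ _⟩
  push Not at hall
  obtain ⟨i, hi⟩ := hall
  have hi := (hK i).resolve_left hi
  -- The lift for one torsion-free index serves for all indices.
  obtain ⟨a, ha⟩ := hi.map_surjective ((z i).app ((M i).toQuotient.obj K))
  refine ⟨L.toQuotient.map a, fun j => ?_⟩
  rw [quotientFunctor_map]
  obtain hj | hj := hK j
  · exact (isZero_toQuotient_obj hj).eq_of_src _ _
  obtain ⟨b, hb⟩ := hj.map_surjective ((z j).app ((M j).toQuotient.obj K))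
  rw [← hb]
  congr 1
  -- `K` is torsion-free for the join, so equality in that quotient is equality in `C`.
  refine (torsionFree_sup_of_injective hi hj).map_injective ?_
  have := congrArg (fun t : (M i ⊔ M j).Center => t.app ((M i ⊔ M j).toQuotient.obj K)) (hz i j)
  simp only [centerMap_app] at this
  rwa [← ha, ← hb, quotientFunctor_map, quotientFunctor_map] at this

/-- Induction on the set of indices still undecided: splitting along `M i` decides `i` on both
summands, and earlier decisions pass to direct summands. -/
theorem exists_isGluingAt_of_injective [IsGrothendieckAbelian.{w} C] [Finite ι]
    (hM : ∀ i, (M i).IsStable)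
    (hz : ∀ i j, centerMap (le_sup_left : M i ≤ M i ⊔ M j) (z i) =
      centerMap (le_sup_right : M j ≤ M i ⊔ M j) (z j)) (E : C) [Injective E] :
    ∃ e, IsGluingAt h z E e := by
  classical
  have := Fintype.ofFinite ι
  suffices ∀ (s : Finset ι) (E : C), Injective E →
      (∀ i ∉ s, (M i).obj E ∨ (M i).TorsionFree E) → ∃ e, IsGluingAt h z E e from
    this Finset.univ E inferInstance fun i hi => (hi (Finset.mem_univ i)).elim
  intro s
  induction s using Finset.induction_on with
  | empty => exact fun E _ hE => exists_isGluingAt_of_decided hz fun i => hE i (by simp)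
  | insert i s _ ih =>
    intro E _ hE
    obtain ⟨T, F, a, hTi, hFi, hT, hF⟩ := (hM i).exists_iso_biprod E
    refine exists_isGluingAt_of_total (p := a.hom ≫ biprod.fst)
      (j := biprod.inl ≫ a.inv) (p' := a.hom ≫ biprod.snd) (j' := biprod.inr ≫ a.inv)
      (by
        simp only [Category.assoc, ← Preadditive.comp_add]
        rw [← Category.assoc biprod.fst, ← Category.assoc biprod.snd, ← Preadditive.add_comp,
          biprod.total, Category.id_comp, a.hom_inv_id])
      (ih T hTi fun j hj => ?_) (ih F hFi fun j hj => ?_)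
    · by_cases hji : j = i
      · exact Or.inl (hji ▸ hT)
      · refine (hE j (by simp [hji, hj])).imp (fun hX => ?_) fun hX => ?_
        · exact (M j).obj.prop_of_mono (biprod.inl ≫ a.inv) hX
        · exact hX.of_mono (biprod.inl ≫ a.inv)
    · by_cases hji : j = i
      · exact Or.inr (hji ▸ hF)
      · refine (hE j (by simp [hji, hj])).imp (fun hX => ?_) fun hX => ?_
        · exact (M j).obj.prop_of_mono (biprod.inr ≫ a.inv) hX
        · exact hX.of_mono (biprod.inr ≫ a.inv)

theorem exists_isGluingAt [IsGrothendieckAbelian.{w} C] [Finite ι]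
    (hL : ∀ X, (∀ i, (M i).obj X) → L.obj X) (hM : ∀ i, (M i).IsStable)
    (hz : ∀ i j, centerMap (le_sup_left : M i ≤ M i ⊔ M j) (z i) =
      centerMap (le_sup_right : M j ≤ M i ⊔ M j) (z j)) (X : C) :
    ∃ e, IsGluingAt h z X e := by
  have : EnoughInjectives C := IsGrothendieckAbelian.enoughInjectives.{w}
  let d := Injective.ι X
  -- `X` is the kernel of `d'`, a map between injectives; naturality along `d'` lets `e₀` restrict
  -- to `X` in `C/L`.
  let d' := cokernel.π d ≫ Injective.ι (cokernel d)
  obtain ⟨e₀, he₀⟩ := exists_isGluingAt_of_injective (h := h) hM hz (Injective.under X)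
  obtain ⟨e₁, he₁⟩ := exists_isGluingAt_of_injective (h := h) hM hz (Injective.under (cokernel d))
  have hmono : Mono (Injective.ι (cokernel d)) := Injective.ι_mono _
  have hnat := he₀.naturality hL he₁ d'
  have := ObjectProperty.SerreClassLocalization.preservesKernel L.toQuotient L.obj d'
  have hk : IsLimit (KernelFork.ofι d (show d ≫ d' = 0 by simp [d'])) :=
    isKernelCompMono (Abelian.monoIsKernelOfCokernel _ (cokernelIsCokernel d))
      (Injective.ι (cokernel d)) rfl
  have hk' : ∃ e : L.toQuotient.obj X ⟶ L.toQuotient.obj X,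
      e ≫ L.toQuotient.map d = L.toQuotient.map d ≫ e₀ := by
    have hlim := (KernelFork.isLimitMapConeEquiv _ L.toQuotient).1
      (isLimitOfPreserves L.toQuotient hk)
    obtain ⟨e, he⟩ := KernelFork.IsLimit.lift' hlim (L.toQuotient.map d ≫ e₀) (by
      rw [Category.assoc, ← hnat, ← Category.assoc, ← Functor.map_comp]
      simp [d'])
    exact ⟨e, he⟩
  obtain ⟨e, he⟩ := hk'
  refine ⟨e, fun i => ?_⟩
  refine (cancel_mono ((M i).toQuotient.map d)).1 ?_
  have h1 := congrArg (quotientFunctor (h i)).map he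
  rw [Functor.map_comp, Functor.map_comp, he₀ i, quotientFunctor_map] at h1
  exact h1.trans (CatCenter.naturality _ _)

/-- Compatible elements of the centers of the `C/(M i)` glue to an element of the center of `C/L`,
if `L` is the intersection of the stable localizing subcategories `M i`. -/
theorem exists_centerMap_eq [IsGrothendieckAbelian.{w} C] [Finite ι]
    (hL : ∀ X, (∀ i, (M i).obj X) → L.obj X) (hM : ∀ i, (M i).IsStable)
    (hz : ∀ i j, centerMap (le_sup_left : M i ≤ M i ⊔ M j) (z i) =
      centerMap (le_sup_right : M j ≤ M i ⊔ M j) (z j)) :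
    ∃ y : L.Center, ∀ i, centerMap (h i) y = z i := by
  choose e he using exists_isGluingAt (h := h) hL hM hz
  let τ : L.toQuotient ⟶ L.toQuotient :=
    { app := e
      naturality := fun X Y f => (he X).naturality hL (he Y) f }
  let y : L.Center := Localization.liftNatTrans L.toQuotient L.obj.isoModSerre L.toQuotient
    L.toQuotient (𝟭 _) (𝟭 _) τ
  have hy : ∀ X, y.app (L.toQuotient.obj X) = e X := fun X => by
    refine (Localization.liftNatTrans_app _ _ _ _ _ _ _ _).trans ?_
    simp [τ]
  refine ⟨y, fun i => center_ext fun X => ?_⟩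
  rw [centerMap_app, hy]
  exact he X i

theorem eq_of_centerMap_eq (h : ∀ i, L ≤ M i) (hL : ∀ X, (∀ i, (M i).obj X) → L.obj X)
    {y y' : L.Center} (hy : ∀ i, centerMap (h i) y = centerMap (h i) y') : y = y' :=
  center_ext fun X => hom_ext_of_quotientFunctor_map_eq h hL fun i => by
    rw [← centerMap_app, ← centerMap_app, hy]

end Gluing

end LocalizingSubcategory

/-! ### Joins of stable subcategories and distributivity. -/

theorem isEssentialExtension_id {C : Type u} [Category.{v} C] [Abelian C] (X : C) :
    IsEssentialExtension (𝟙 X) :=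
  ⟨inferInstance, fun Z g _ hZ => by
    rw [IsZero.iff_id_eq_zero, ← pullback.lift_snd (f := 𝟙 X) (g := g) g (𝟙 Z) (by simp),
      hZ.eq_of_src (pullback.snd _ _) 0, comp_zero]⟩

namespace LocalizingSubcategory

section

variable {C : Type u} [Category.{v} C] [Abelian C] [IsGrothendieckAbelian.{w} C]
  {A B : LocalizingSubcategory.{w} C}

/-- An essential extension of an object of the join `A ⊔ B` of stable localizing subcategories
embeds into the sum of an object of `A` and an object of `B`. -/
theorem exists_mono_biprod_of_sup (hA : A.IsStable) (hB : B.IsStable) {X Y : C} {f : X ⟶ Y}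
    (hf : IsEssentialExtension f) (hX : (A ⊔ B).obj X) :
    ∃ (S T : C) (m : Y ⟶ S ⊞ T), Mono m ∧ A.obj S ∧ B.obj T := by
  have : EnoughInjectives C := IsGrothendieckAbelian.enoughInjectives.{w}
  -- `Y` embeds in an injective `S ⊞ T ⊞ G` with `G` torsion-free for `A` and `B`, hence for the
  -- join.
  obtain ⟨S, F, a, _, _, hS, hF⟩ := hA.exists_iso_biprod (Injective.under Y)
  obtain ⟨T, G, b, _, _, hT, hG⟩ := hB.exists_iso_biprod F
  have hGA : A.TorsionFree G := hF.of_mono (biprod.inr ≫ b.inv)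
  let n : Y ⟶ S ⊞ F := Injective.ι Y ≫ a.hom
  let m : Y ⟶ S ⊞ T := n ≫ biprod.map (𝟙 S) (b.hom ≫ biprod.fst)
  let q : Y ⟶ G := n ≫ biprod.snd ≫ b.hom ≫ biprod.snd
  have hn : Mono n := mono_comp _ _
  have hmq : ∀ {Z : C} (g : Z ⟶ Y), g ≫ m = 0 → g ≫ q = 0 → g = 0 := fun g hm hq => by
    rw [← cancel_mono n, zero_comp]
    ext
    · simpa [m] using congrArg (· ≫ biprod.fst) hm
    · rw [← cancel_mono b.hom, zero_comp, zero_comp]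
      ext
      · simpa [m] using congrArg (· ≫ biprod.snd) hm
      · simpa [q] using hq
  refine ⟨S, T, m, ?_, hS, hT⟩
  -- The kernel of `m` embeds in `G`, so its intersection with `X`, which is in the join, vanishes;
  -- essentiality kills the kernel itself.
  have hk : Mono (kernel.ι m ≫ q) := Preadditive.mono_of_cancel_zero _ fun g hg => by
    rw [← cancel_mono (kernel.ι m), zero_comp]
    exact hmq _ (by simp) (by simpa using hg)
  have hfm := hf.1
  refine Preadditive.mono_of_kernel_zero ((hf.2 _ (kernel.ι m) inferInstance ?_).eq_of_src _ _)
  have hP : (A ⊔ B).obj (pullback f (kernel.ι m)) := (A ⊔ B).obj.prop_of_mono (pullback.fst _ _) hX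
  rw [IsZero.iff_id_eq_zero, ← cancel_mono (pullback.snd f (kernel.ι m) ≫ kernel.ι m ≫ q)]
  exact (torsionFree_sup_of_injective hGA hG hP _).trans
    (torsionFree_sup_of_injective hGA hG hP _).symm

theorem IsStable.sup (hA : A.IsStable) (hB : B.IsStable) : (A ⊔ B).IsStable := by
  intro X Y f hf hX
  obtain ⟨S, T, m, _, hS, hT⟩ := exists_mono_biprod_of_sup hA hB hf hX
  exact (A ⊔ B).obj.prop_of_mono m ((A ⊔ B).obj.prop_biprod
    ((le_sup_left : A ≤ A ⊔ B) _ hS) ((le_sup_right : B ≤ A ⊔ B) _ hT))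

/-- `X` embeds in some `S ⊞ T`; the part killed by projection to `S` embeds in `T`, so it is
`B`-torsion and vanishes. -/
theorem obj_of_sup_of_torsionFree (hA : A.IsStable) (hB : B.IsStable) {X : C}
    (hX : (A ⊔ B).obj X) (hXB : B.TorsionFree X) : A.obj X := by
  obtain ⟨S, T, m, _, hS, hT⟩ := exists_mono_biprod_of_sup hA hB (isEssentialExtension_id X) hX
  have hk : Mono (kernel.ι (m ≫ biprod.fst) ≫ m ≫ biprod.snd) :=
    Preadditive.mono_of_cancel_zero _ fun g hg => by
      rw [← cancel_mono (kernel.ι (m ≫ biprod.fst)), ← cancel_mono m, zero_comp, zero_comp]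
      ext
      · simp
      · simpa using hg
  have : Mono (m ≫ biprod.fst) := Preadditive.mono_of_kernel_zero
    (hXB (B.obj.prop_of_mono (kernel.ι (m ≫ biprod.fst) ≫ m ≫ biprod.snd) hT) _)
  exact A.obj.prop_of_mono (m ≫ biprod.fst) hS

/-- Joins of stable localizing subcategories distribute over intersections. -/
theorem iInf_sup_le {ι : Type*} {M : ι → LocalizingSubcategory.{w} C} {L : LocalizingSubcategory C}
    (hM : ∀ i, (M i).IsStable) (hL : L.IsStable) (hle : ⨅ i, M i ≤ L) : ⨅ i, (M i ⊔ L) ≤ L := by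
  intro X hX
  rw [iInf_obj_iff] at hX
  obtain ⟨T, F, i, p, w, hS, hT, hF⟩ := L.exists_shortExact X
  have := hS.epi_g
  -- It suffices to treat the torsion-free quotient `F`, which lies in every `M i`.
  refine L.obj.prop_X₂_of_shortExact hS hT (hle _ ((iInf_obj_iff _ _).2 fun i => ?_))
  exact obj_of_sup_of_torsionFree (hM i) hL ((M i ⊔ L).obj.prop_of_epi p (hX i)) hF

end

end LocalizingSubcategory

/-! ### The site and the sheaf condition. -/

namespace StableLocalizing

variable {C : Type u} [Category.{v} C] [Abelian C]

theorem ofArrows_mem_stableCoverings {ι : Type*} [Finite ι] {L : StableLocalizing.{w} C}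
    {M : ι → StableLocalizing.{w} C} (f : ∀ i, M i ⟶ L)
    (h : L.toLocalizing = ⨅ i, (M i).toLocalizing) :
    Presieve.ofArrows M f ∈ (stableCoverings.{w} C).coverings L := by
  obtain ⟨n, ⟨e⟩⟩ := Finite.exists_equiv_fin ι
  exact ⟨n, M ∘ e.symm, fun i => f (e.symm i),
    (Presieve.ofArrows_comp_eq_of_surjective f e.symm.surjective).symm,
    h.trans (e.symm.iInf_comp (g := fun i => (M i).toLocalizing)).symm⟩

variable [IsGrothendieckAbelian.{w} C]

/-- The join of two stable localizing subcategories. -/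
def join (A B : StableLocalizing.{w} C) : StableLocalizing.{w} C :=
  OrderDual.toDual ⟨A.toLocalizing ⊔ B.toLocalizing,
    (OrderDual.ofDual A).2.sup (OrderDual.ofDual B).2⟩

/-- The morphism from the join to the first factor. -/
def joinFst (A B : StableLocalizing.{w} C) : join A B ⟶ A :=
  homOfLE (show A.toLocalizing ≤ A.toLocalizing ⊔ B.toLocalizing from le_sup_left)

/-- The morphism from the join to the second factor. -/
def joinSnd (A B : StableLocalizing.{w} C) : join A B ⟶ B :=
  homOfLE (show B.toLocalizing ≤ A.toLocalizing ⊔ B.toLocalizing from le_sup_right)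

theorem isPullback_join {A B L : StableLocalizing.{w} C} (f : A ⟶ L) (g : B ⟶ L) :
    IsPullback (joinFst A B) (joinSnd A B) f g where
  w := Subsingleton.elim _ _
  isLimit' := ⟨PullbackCone.IsLimit.mk _
    (fun s => homOfLE (show A.toLocalizing ⊔ B.toLocalizing ≤ toLocalizing s.pt from
      sup_le (le_of_hom s.fst) (le_of_hom s.snd)))
    (fun _ => Subsingleton.elim _ _) (fun _ => Subsingleton.elim _ _)
    fun _ _ _ _ => Subsingleton.elim _ _⟩

instance : HasPullbacks (StableLocalizing.{w} C) :=
  have {A B L : StableLocalizing.{w} C} {f : A ⟶ L} {g : B ⟶ L} : HasLimit (cospan f g) :=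
    (isPullback_join f g).hasPullback
  hasPullbacks_of_hasLimit_cospan _

theorem toLocalizing_pullback {A B L : StableLocalizing.{w} C} (f : A ⟶ L) (g : B ⟶ L) :
    (pullback f g).toLocalizing = A.toLocalizing ⊔ B.toLocalizing :=
  le_antisymm (le_of_hom (isPullback_join f g).isoPullback.hom)
    (le_of_hom (isPullback_join f g).isoPullback.inv)

variable (C)

/-- The pretopology on the stable localizing subcategories whose coverings are the finite
intersections. -/
noncomputable def pretopology : Pretopology (StableLocalizing.{w} C) where
  toPrecoverage := stableCoverings.{w} C
  has_isos L M f _ := by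
    rw [← Presieve.ofArrows_pUnit.{0}]
    refine ofArrows_mem_stableCoverings _ ?_
    rw [iInf_const]
    exact le_antisymm (le_of_hom f) (le_of_hom (inv f))
  pullbacks L L' g R := by
    rintro ⟨n, M, f, rfl, hL⟩
    rw [← Presieve.ofArrows_pullback]
    refine ofArrows_mem_stableCoverings _ ?_
    simp only [toLocalizing_pullback]
    -- Pullback stability is exactly distributivity of joins over the intersection.
    exact le_antisymm (le_iInf fun i => le_sup_right)
      (LocalizingSubcategory.iInf_sup_le (fun i => (OrderDual.ofDual (M i)).2)
        (OrderDual.ofDual L').2 (hL ▸ le_of_hom g))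
  transitive L R T := by
    rintro ⟨n, M, f, rfl, hL⟩ hT
    choose k N g hg hN using hT
    have : (Presieve.ofArrows M f).bind T =
        (Presieve.ofArrows M f).bind fun _ f H => Presieve.ofArrows (N f H) (g f H) := by
      congr
      funext _ f H
      exact hg f H
    rw [this, Presieve.ofArrows_bind]
    refine ofArrows_mem_stableCoverings _ ?_
    rw [iInf_sigma, hL]
    exact iInf_congr fun i => hN _ _

theorem isSheaf_centralPresheaf :
    Presheaf.IsSheaf (pretopology.{w} C).toGrothendieck (centralPresheaf.{w} C) := by
  refine (Presheaf.isSheaf_iff_isSheaf_comp _ (centralPresheaf.{w} C)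
    (forget CommRingCat.{max u v})).2 ?_
  rw [isSheaf_iff_isSheaf_of_type, Presieve.isSheaf_pretopology]
  rintro L _ ⟨n, M, f, rfl, hL⟩
  rw [Presieve.isSheafFor_arrows_iff]
  intro x hx
  have hle : ∀ i, L.toLocalizing ≤ (M i).toLocalizing := fun i => le_of_hom (f i)
  have hL' : ∀ X, (∀ i, (M i).toLocalizing.obj X) → L.toLocalizing.obj X := fun X hX => by
    rw [hL]
    exact (LocalizingSubcategory.iInf_obj_iff _ _).2 hX
  -- Matching families need only be tested on the joins.
  obtain ⟨y, hy⟩ := LocalizingSubcategory.exists_centerMap_eq (h := hle) (z := x) hL'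
    (fun i => (OrderDual.ofDual (M i)).2) fun i j =>
      hx i j (join (M i) (M j)) (joinFst _ _) (joinSnd _ _) (Subsingleton.elim _ _)
  exact ⟨y, hy, fun y' hy' => LocalizingSubcategory.eq_of_centerMap_eq hle hL' fun i =>
    (hy' i).trans (hy i).symm⟩

end StableLocalizing

theorem theorem1p1 (C : Type u) [Category.{v} C] [Abelian C] [IsGrothendieckAbelian.{w} C] :
    -- the coverings make the stable localizing subcategories a site, and `L ↦ Z(C/L)` is a sheaf
    (∃ (_ : HasPullbacks (StableLocalizing.{w} C)) (K : Pretopology (StableLocalizing.{w} C)),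
      K.toPrecoverage = stableCoverings.{w} C ∧
        Presheaf.IsSheaf K.toGrothendieck (centralPresheaf.{w} C)) ∧
    -- the exact sequence `0 → Z(C/⋂ Lᵢ) → ∏ Z(C/Lᵢ) ⇉ ∏ Z(C/(Lᵢ ∨ Lⱼ))`
    (∀ (n : ℕ) (L : Fin n → LocalizingSubcategory.{w} C), (∀ i, (L i).IsStable) →
      Function.Injective (fun (z : (⨅ i, L i).Center) (i : Fin n) =>
        LocalizingSubcategory.centerMap (iInf_le L i) z) ∧
      ∀ z : (i : Fin n) → (L i).Center,
        (∃ y : (⨅ i, L i).Center, ∀ i,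
          LocalizingSubcategory.centerMap (iInf_le L i) y = z i) ↔
        ∀ i j, LocalizingSubcategory.centerMap (le_sup_left : L i ≤ L i ⊔ L j) (z i) =
          LocalizingSubcategory.centerMap (le_sup_right : L j ≤ L i ⊔ L j) (z j)) := by
  refine ⟨⟨inferInstance, StableLocalizing.pretopology C, rfl,
    StableLocalizing.isSheaf_centralPresheaf C⟩, fun n L hstable => ⟨fun y y' hy => ?_,
      fun z => ⟨?_, fun hz => ?_⟩⟩⟩
  · exact LocalizingSubcategory.eq_of_centerMap_eq (fun i => iInf_le L i)
      (fun X => (LocalizingSubcategory.iInf_obj_iff L X).2) fun i => congrFun hy i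
  · rintro ⟨y, hy⟩ i j
    -- Both sides are the restriction of `y` to the join.
    rw [← hy i, ← hy j, ← LocalizingSubcategory.centerMap_trans,
      ← LocalizingSubcategory.centerMap_trans]
  · exact LocalizingSubcategory.exists_centerMap_eq
      (fun X => (LocalizingSubcategory.iInf_obj_iff L X).2) hstable hz
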